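/- Let $\gamma>1$, $\theta=\frac{\gamma-1}{2}$, $p(\rho)=\frac{\theta^2}{\gamma}\rho^\gamma$, $\alpha>0$, $\varepsilon>0$, $R>0$, and let $\mathbb T=\mathbb R/\mathbb Z$. Let $\chi_R$ be a smooth real function with $\chi_R(s)=1$ for $0\le s\le R/2$, $\chi_R(s)=0$ for $s>R$, and $\chi_R$ strictly decreasing on $[R/2,R]$. For functions $\rho,q$ on $\mathbb T$ put $$\chi_R(\rho,q)=\chi_R\big(\|\rho^{-1}\|_{L^\infty(\mathbb T)}\big)\,\chi_R\big(\|q\|_{H^2(\mathbb T)}\big),\qquad \chi_R(\infty)=0.$$ For $\delta\ge 0$ consider on $[0,\infty)\times\mathbb T$ the system $$\partial_t\rho+\chi_R(\rho,q)\,\partial_x q=-\delta\rho+\varepsilon\,\partial_x^2\rho,\qquad \partial_t q+\chi_R(\rho,q)\,\partial_x\Big(\frac{q^2}{\rho}+p(\rho)\Big)=-\alpha q+\varepsilon\,\partial_x^2 q. \tag{$S_\delta$}$$ For $\kappa>0$ let $$\Lambda_\kappa=\{(\rho,q)\in(0,\infty)\times\mathbb R:\ -\kappa\le z\le w\le\kappa\},\qquad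 z=\frac q\rho-\rho^\theta,\quad w=\frac q\rho+\rho^\theta.$$ A global classical solution of $(S_\delta)$ is a pair $(\rho,q)$ of continuous functions on $[0,\infty)\times\mathbb T$ which for $t>0$ are differentiable in $t$ and twice continuously differentiable in $x$ and satisfy $(S_\delta)$ at every point of $(0,\infty)\times\mathbb T$. Then for every $\kappa>0$ the region $\Lambda_\kappa$, which does not depend on $R$, is invariant in the following sense. (i) Let $\rho_0,q_0\in C^\infty(\mathbb T)$ satisfy $(\rho_0(x),q_0(x))\in\Lambda_\kappa$ for all $x\in\mathbb T$. Then every global classical solution $(\rho,q)$ of the truncated damped viscous system $(S_0)$ with initial data $(\rho_0,q_0)$ satisfies $(\rho(t,x),q(t,x))\in\Lambda_\kappa$ for all $t\ge 0$ and $x\in\mathbb T$; in particular $\rho>0$ everywhere. (ii) The same holds for the perturbed system $(S_\delta)$ whenever $0<\delta<\alpha$. -/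

import Mathlib

open scoped ContDiff ENNReal

noncomputable section

namespace TruncatedEuler

/- Functions on the one-dimensional torus `ℝ / ℤ` are represented by `1`-periodic functions on `ℝ`.
A space-time function is written `f t x`, with time first. -/

/-- The exponent `θ = (γ - 1) / 2`. -/
def theta (γ : ℝ) : ℝ := (γ - 1) / 2

/-- The pressure law `p(ρ) = (θ ^ 2 / γ) ρ ^ γ`. -/
def pressure (γ r : ℝ) : ℝ := theta γ ^ 2 / γ * r ^ γ

/-- The Riemann invariant `z = q / ρ - ρ ^ θ`, as a function of the state `(ρ, q)`. -/
def riemannZ (γ : ℝ) (U : ℝ × ℝ) : ℝ := U.2 / U.1 - U.1 ^ theta γ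

/-- The Riemann invariant `w = q / ρ + ρ ^ θ`, as a function of the state `(ρ, q)`. -/
def riemannW (γ : ℝ) (U : ℝ × ℝ) : ℝ := U.2 / U.1 + U.1 ^ theta γ

/-- The region `Λ_κ = {(ρ, q) ∈ (0, ∞) × ℝ : -κ ≤ z ≤ w ≤ κ}`. -/
def region (γ κ : ℝ) : Set (ℝ × ℝ) :=
  {U | 0 < U.1 ∧ -κ ≤ riemannZ γ U ∧ riemannZ γ U ≤ riemannW γ U ∧ riemannW γ U ≤ κ}

/-- `χ` is a cutoff profile `χ_R` at level `R`. Only its values on `[0, ∞)` are ever used, since it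
is evaluated at norms only. -/
structure IsCutoff (R : ℝ) (χ : ℝ → ℝ) : Prop where
  smooth : ContDiff ℝ ∞ χ
  eq_one : ∀ s, 0 ≤ s → s ≤ R / 2 → χ s = 1
  eq_zero : ∀ s, R < s → χ s = 0
  strictAnti : StrictAntiOn χ (Set.Icc (R / 2) R)

/-- The supremum norm of `ρ⁻¹`, with value `∞` if `ρ` vanishes somewhere
(`‖0‖ₑ⁻¹ = ∞` in `[0, ∞]`) or if `ρ⁻¹` is unbounded. -/
def supNormInv (ρ : ℝ → ℝ) : ℝ≥0∞ := ⨆ x : ℝ, ‖ρ x‖ₑ⁻¹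

/-- The norm of `H²` of the torus, for a twice continuously differentiable `1`-periodic function. -/
def H2norm (q : ℝ → ℝ) : ℝ :=
  Real.sqrt (∫ x in (0 : ℝ)..1, (q x ^ 2 + deriv q x ^ 2 + deriv (deriv q) x ^ 2))

/-- The truncation factor `χ_R(ρ, q) = χ_R(‖ρ⁻¹‖_{L^∞}) χ_R(‖q‖_{H²})`, with the value
`χ_R(∞) = 0`. -/
def truncation (χ : ℝ → ℝ) (ρ q : ℝ → ℝ) : ℝ :=
  (if supNormInv ρ = ⊤ then 0 else χ (supNormInv ρ).toReal) * χ (H2norm q)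

/-- `(ρ, q)` is a global classical solution on `[0, ∞) × 𝕋` of
`∂ₜρ + χ_R(ρ, q) ∂ₓq = -δ ρ + ε ∂ₓ²ρ`,
`∂ₜq + χ_R(ρ, q) ∂ₓ(q² / ρ + p(ρ)) = -α q + ε ∂ₓ²q`:
it is continuous up to time `0`, twice continuously differentiable in `x` and differentiable in `t`
at positive times, and satisfies the equations there. Positivity of `ρ` is not part of the
definition. -/
structure IsClassicalSolution (γ α ε δ : ℝ) (χ : ℝ → ℝ) (ρ q : ℝ → ℝ → ℝ) : Prop where
  periodic_rho : ∀ t, 0 ≤ t → Function.Periodic (ρ t) 1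
  periodic_q : ∀ t, 0 ≤ t → Function.Periodic (q t) 1
  continuous_rho : ContinuousOn (fun p : ℝ × ℝ => ρ p.1 p.2) (Set.Ici 0 ×ˢ Set.univ)
  continuous_q : ContinuousOn (fun p : ℝ × ℝ => q p.1 p.2) (Set.Ici 0 ×ˢ Set.univ)
  contDiff_rho : ∀ t, 0 < t → ContDiff ℝ 2 (ρ t)
  contDiff_q : ∀ t, 0 < t → ContDiff ℝ 2 (q t)
  mass_eq : ∀ t, 0 < t → ∀ x,
    HasDerivAt (fun s => ρ s x)
      (-(truncation χ (ρ t) (q t) * deriv (q t) x)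
        - δ * ρ t x + ε * deriv (deriv (ρ t)) x) t
  momentum_eq : ∀ t, 0 < t → ∀ x,
    HasDerivAt (fun s => q s x)
      (-(truncation χ (ρ t) (q t) * deriv (fun y => q t y ^ 2 / ρ t y + pressure γ (ρ t y)) x)
        - α * q t x + ε * deriv (deriv (q t)) x) t

/-- `Λ` is an invariant region for the system with parameters `γ, α, ε, δ` and cutoff `χ`: every
global classical solution that starts from spatially smooth data with values in `Λ` has values in
`Λ` at all times. -/
def IsInvariantRegion (γ α ε δ : ℝ) (χ : ℝ → ℝ) (Λ : Set (ℝ × ℝ)) : Prop :=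
  ∀ ρ₀ q₀ : ℝ → ℝ, ContDiff ℝ ∞ ρ₀ → ContDiff ℝ ∞ q₀ →
    Function.Periodic ρ₀ 1 → Function.Periodic q₀ 1 →
    (∀ x, (ρ₀ x, q₀ x) ∈ Λ) →
    ∀ ρ q : ℝ → ℝ → ℝ, IsClassicalSolution γ α ε δ χ ρ q → ρ 0 = ρ₀ → q 0 = q₀ →
      ∀ t, 0 ≤ t → ∀ x, (ρ t x, q t x) ∈ Λ

end TruncatedEuler

end

/-!
The truncation makes the vacuum harmless. As soon as `ρ(t, ·)` takes a positive value below `1 / R`,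
the factor `χ_R(ρ, q)` vanishes and the mass equation is the damped heat equation, whose minimum
decays at most exponentially; hence `ρ > 0` at all times (`IsClassicalSolution.rho_pos`).

Once `ρ > 0`, put `u = q / ρ` and, for a sign `σ = ± 1`, `W = σ u + ρ ^ θ`, so that `W = w` for
`σ = 1` and `W = -z` for `σ = -1`. With `c` the truncation factor, the system gives
`W_t + c (u + σ θ ρ ^ θ) W_x
  = ε W_xx - ε θ (θ - 1) ρ ^ (θ - 2) ρ_x² + 2 ε σ ρ_x u_x / ρ - (α - δ) σ u - δ θ ρ ^ θ`.
At a spatial maximum `W_x = 0`, so that the transport term drops out whatever the size of `c`, and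
`σ u_x = -θ ρ ^ (θ - 1) ρ_x` turns the two middle terms into `-ε θ (θ + 1) ρ ^ (θ - 2) ρ_x² ≤ 0`.
If moreover `-W` for the opposite sign has not passed the same level, then `σ u ≥ 0`, and the source
terms are nonpositive because `0 ≤ δ ≤ α`. Therefore `W_t ≤ 0` there (`riemann_source_nonpos`), and
neither `w` nor `-z` can be the first to cross the barrier `κ + η (1 + t)`; let `η → 0`.

Both steps use the same first-crossing principle (`exists_first_crossing`). It needs only pointwise
differentiability in time, so no regularity in `t` of the truncation factor enters.
-/

open scoped Topology
open Set Filter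

namespace TruncatedEuler

/-! ### Maximum principle tools -/

/-- A continuous function on `[0, ∞) × 𝕋` that is negative at time `0` and not always negative has a
first crossing point. -/
theorem exists_first_crossing {G : ℝ → ℝ → ℝ}
    (hc : ContinuousOn (fun p : ℝ × ℝ => G p.1 p.2) (Ici 0 ×ˢ univ))
    (hper : ∀ t, 0 ≤ t → Function.Periodic (G t) 1) (h0 : ∀ x, G 0 x < 0)
    {T X : ℝ} (hT : 0 ≤ T) (hG : 0 ≤ G T X) :
    ∃ t, 0 < t ∧ (∀ s, 0 ≤ s → s < t → ∀ x, G s x < 0) ∧ (∀ x, G t x ≤ 0) ∧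
      ∃ x, G t x = 0 := by
  have hsub : Icc (0 : ℝ) T ×ˢ Icc (0 : ℝ) 1 ⊆ Ici 0 ×ˢ univ :=
    prod_mono Icc_subset_Ici_self (subset_univ _)
  have hK : IsCompact ((Icc (0 : ℝ) T ×ˢ Icc (0 : ℝ) 1) ∩
      (fun p : ℝ × ℝ => G p.1 p.2) ⁻¹' Ici 0) :=
    (isCompact_Icc.prod isCompact_Icc).of_isClosed_subset
      ((hc.mono hsub).preimage_isClosed_of_isClosed
        (isClosed_Icc.prod isClosed_Icc) isClosed_Ici) inter_subset_left
  have hmem : ∀ s, 0 ≤ s → s ≤ T → ∀ x, 0 ≤ G s x → ∃ y, (s, y) ∈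
      (Icc (0 : ℝ) T ×ˢ Icc (0 : ℝ) 1) ∩ (fun p : ℝ × ℝ => G p.1 p.2) ⁻¹' Ici 0 := by
    intro s hs hsT x hx
    obtain ⟨y, hy, hxy⟩ := (hper s hs).exists_mem_Ico₀ one_pos x
    exact ⟨y, ⟨⟨hs, hsT⟩, hy.1, hy.2.le⟩, show 0 ≤ G s y from hxy ▸ hx⟩
  obtain ⟨Y, hY⟩ := hmem T hT le_rfl X hG
  obtain ⟨⟨t, x⟩, ⟨⟨⟨ht0, htT⟩, -⟩, hx⟩, hmin⟩ :=
    hK.exists_isMinOn ⟨_, hY⟩ continuous_fst.continuousOn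
  simp only at ht0 htT
  have hx' : 0 ≤ G t x := hx
  have htpos : 0 < t := lt_of_le_of_ne ht0 fun h => by
    subst h; exact (h0 x).not_ge hx'
  have hbefore : ∀ s, 0 ≤ s → s < t → ∀ y, G s y < 0 := by
    intro s hs hst y
    by_contra! hy
    obtain ⟨y', hy'⟩ := hmem s hs (hst.le.trans htT) y hy
    exact hst.not_ge (hmin hy')
  have hle : ∀ y, G t y ≤ 0 := by
    intro y
    have hcy : ContinuousOn (fun s => G s y) (Ici 0) :=
      hc.comp (f := fun s : ℝ => (s, y)) (by fun_prop) fun s hs => ⟨hs, mem_univ _⟩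
    have hlim : Tendsto (fun s => G s y) (𝓝[<] t) (𝓝 (G t y)) :=
      ((hcy t ht0).continuousAt (Ici_mem_nhds htpos)).tendsto.mono_left nhdsWithin_le_nhds
    refine le_of_tendsto hlim ?_
    filter_upwards [self_mem_nhdsWithin, nhdsWithin_le_nhds (Ioi_mem_nhds htpos)] with s hs hs0
    exact (hbefore s (le_of_lt hs0) hs y).le
  exact ⟨t, htpos, hbefore, hle, x, (hle x).antisymm hx'⟩

theorem deriv_nonneg_of_neg_before {f : ℝ → ℝ} {d t : ℝ} (ht : 0 < t) (hf : HasDerivAt f d t)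
    (h0 : f t = 0) (hneg : ∀ s, 0 ≤ s → s < t → f s < 0) : 0 ≤ d := by
  have hlim : Tendsto (slope f t) (𝓝[<] t) (𝓝 d) :=
    (hasDerivAt_iff_tendsto_slope.1 hf).mono_left
      (nhdsWithin_mono _ fun s hs => ne_of_lt hs)
  refine ge_of_tendsto hlim ?_
  filter_upwards [self_mem_nhdsWithin, nhdsWithin_le_nhds (Ioi_mem_nhds ht)] with s hs hs0
  rw [slope_def_field, h0]
  exact div_nonneg_of_nonpos (by linarith [hneg s (le_of_lt hs0) hs]) (sub_nonpos.2 (le_of_lt hs))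

theorem deriv_deriv_nonpos_of_isLocalMax {f : ℝ → ℝ} {x : ℝ} (h : IsLocalMax f x)
    (hf : ContinuousAt f x) : deriv (deriv f) x ≤ 0 := by
  by_contra! hpos
  have hmin : IsLocalMin f x := isLocalMin_of_deriv_deriv_pos hpos h.deriv_eq_zero hf
  have hconst : f =ᶠ[𝓝 x] fun _ => f x := by
    filter_upwards [h, hmin] with y h1 h2 using le_antisymm h1 h2
  have : deriv (deriv f) x = 0 := by
    rw [hconst.deriv.deriv_eq]; simp
  exact hpos.ne' this

/-! ### Positivity of the density -/

theorem IsCutoff.truncation_eq_zero {R : ℝ} {χ : ℝ → ℝ} (hχ : IsCutoff R χ) {ρ q : ℝ → ℝ} {x : ℝ}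
    (hx : 0 < ρ x) (hR : ρ x < R⁻¹) : truncation χ ρ q = 0 := by
  unfold truncation
  split_ifs with h
  · simp
  · have h1 : ‖ρ x‖ₑ⁻¹ ≤ supNormInv ρ := le_iSup (fun y => ‖ρ y‖ₑ⁻¹) x
    have h2 := ENNReal.toReal_mono h h1
    rw [ENNReal.toReal_inv, toReal_enorm, Real.norm_of_nonneg hx.le] at h2
    have h3 : R < (ρ x)⁻¹ := lt_inv_of_lt_inv₀ hx hR
    rw [hχ.eq_zero _ (h3.trans_le h2), zero_mul]

variable {γ α ε δ R κ : ℝ} {χ : ℝ → ℝ} {ρ q : ℝ → ℝ → ℝ}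

theorem IsClassicalSolution.rho_pos (hε : 0 < ε) (hδ : 0 ≤ δ) (hR : 0 < R) (hχ : IsCutoff R χ)
    (h : IsClassicalSolution γ α ε δ χ ρ q) (h0 : ∀ x, 0 < ρ 0 x) {t : ℝ} (ht : 0 ≤ t) (x : ℝ) :
    0 < ρ t x := by
  have hc0 : Continuous (ρ 0) := by
    rw [← continuousOn_univ]
    exact h.continuous_rho.comp (f := fun y : ℝ => ((0 : ℝ), y)) (by fun_prop)
      fun y _ => ⟨self_mem_Ici, mem_univ _⟩
  obtain ⟨x₀, -, hx₀⟩ := isCompact_Icc.exists_isMinOn (nonempty_Icc.2 (zero_le_one' ℝ))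
    hc0.continuousOn
  have hmin : ∀ y, ρ 0 x₀ ≤ ρ 0 y := by
    intro y
    obtain ⟨y', hy', e⟩ := (h.periodic_rho 0 le_rfl).exists_mem_Ico₀ one_pos y
    rw [e]; exact hx₀ ⟨hy'.1, hy'.2.le⟩
  -- A level below both the initial minimum and the threshold `1 / R` of the truncation.
  obtain ⟨m, hm0, hm⟩ := exists_between (lt_min (h0 x₀) (inv_pos.2 hR))
  obtain ⟨hm1, hm2⟩ := lt_min_iff.1 hm
  by_contra! hneg
  -- The rate `δ + 1` exceeds the damping rate, so that the barrier is crossed with strict sign.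
  obtain ⟨s, hs, hbef, hle, y, hy⟩ := exists_first_crossing
    (G := fun t x => m - Real.exp ((δ + 1) * t) * ρ t x)
    (continuousOn_const.sub (ContinuousOn.mul (by fun_prop) h.continuous_rho))
    (fun t ht x => by simp only [h.periodic_rho t ht x])
    (fun y => by simpa using hm1.trans_le (hmin y)) (X := x) ht
    (by nlinarith [Real.exp_pos ((δ + 1) * t)])
  have he : 1 ≤ Real.exp ((δ + 1) * s) := Real.one_le_exp (by positivity)
  have hlow : 0 < ρ s y := by
    by_contra! hc; nlinarith
  have hhigh : ρ s y < R⁻¹ := by nlinarith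
  have hloc : IsMinOn (ρ s) univ y := by
    intro z _
    have h1 := hle z
    exact le_of_mul_le_mul_left (by linarith) (one_pos.trans_le he)
  have hxx : 0 ≤ deriv (deriv (ρ s)) y := by
    have h2 : deriv (deriv (fun z => -ρ s z)) y ≤ 0 :=
      deriv_deriv_nonpos_of_isLocalMax (hloc.isLocalMin univ_mem).neg
        (h.contDiff_rho s hs).continuous.neg.continuousAt
    have e : deriv (fun z => -ρ s z) = fun z => -deriv (ρ s) z := funext fun z => deriv.fun_neg
    rw [e, deriv.fun_neg] at h2
    linarith
  have hd := h.mass_eq s hs y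
  rw [hχ.truncation_eq_zero hlow hhigh] at hd
  have hexp : HasDerivAt (fun r : ℝ => Real.exp ((δ + 1) * r))
      (Real.exp ((δ + 1) * s) * (δ + 1)) s := by
    simpa using ((hasDerivAt_id s).const_mul (δ + 1)).exp
  have key := deriv_nonneg_of_neg_before hs ((hexp.mul hd).const_sub m) hy
    fun r hr hrs => hbef r hr hrs y
  nlinarith [mul_pos (one_pos.trans_le he) hlow,
    mul_nonneg (one_pos.trans_le he).le (mul_nonneg hε.le hxx)]

/-! ### The Riemann invariants -/

/-- The function `σ u + ρ ^ θ` of the state `(ρ, q)`, `u = q / ρ`: the Riemann invariant `w` for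
`σ = 1`, and `-z` for `σ = -1`. -/
noncomputable def signedRiemann (γ σ r m : ℝ) : ℝ := σ * (m / r) + r ^ theta γ

theorem hasDerivAt_signedRiemann {f g : ℝ → ℝ} {f' g' x : ℝ} (σ : ℝ) (hf : HasDerivAt f f' x)
    (hg : HasDerivAt g g' x) (hx : 0 < f x) :
    HasDerivAt (fun y => signedRiemann γ σ (f y) (g y))
      (σ * ((g' * f x - g x * f') / f x ^ 2) + f' * theta γ * f x ^ (theta γ - 1)) x :=
  ((hg.div hf hx.ne').const_mul σ).add (hf.rpow_const (Or.inl hx.ne'))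

theorem deriv_deriv_signedRiemann {f g : ℝ → ℝ} (σ x : ℝ) (hf : ContDiff ℝ 2 f)
    (hg : ContDiff ℝ 2 g) (hpos : ∀ y, 0 < f y) :
    deriv (deriv fun y => signedRiemann γ σ (f y) (g y)) x =
      σ * ((deriv (deriv g) x * f x - g x * deriv (deriv f) x) / f x ^ 2
        - 2 * deriv f x * (deriv g x * f x - g x * deriv f x) / f x ^ 3)
      + deriv (deriv f) x * theta γ * f x ^ (theta γ - 1)
      + deriv f x ^ 2 * theta γ * (theta γ - 1) * f x ^ (theta γ - 2) := by
  have hf1 : ∀ y, HasDerivAt f (deriv f y) y := fun y =>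
    (hf.differentiable two_ne_zero y).hasDerivAt
  have hg1 : ∀ y, HasDerivAt g (deriv g y) y := fun y =>
    (hg.differentiable two_ne_zero y).hasDerivAt
  have hf2 : HasDerivAt (deriv f) (deriv (deriv f) x) x :=
    (hf.differentiable_deriv_two x).hasDerivAt
  have hg2 : HasDerivAt (deriv g) (deriv (deriv g) x) x :=
    (hg.differentiable_deriv_two x).hasDerivAt
  rw [funext fun y => (hasDerivAt_signedRiemann (γ := γ) σ (hf1 y) (hg1 y) (hpos y)).deriv]
  have hx := (hpos x).ne'
  have key := ((((hg2.mul (hf1 x)).sub ((hg1 x).mul hf2)).div ((hf1 x).pow 2)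
    (pow_ne_zero 2 hx)).const_mul σ).add
    ((hf2.mul_const (theta γ)).mul ((hf1 x).rpow_const (p := theta γ - 1) (Or.inl hx)))
  refine (key.congr_deriv ?_).deriv
  rw [show theta γ - 1 - 1 = theta γ - 2 by ring]
  simp only [Pi.mul_apply, Pi.sub_apply, Pi.pow_apply]
  field_simp
  ring

theorem deriv_flux {f g : ℝ → ℝ} {f' g' x : ℝ} (hγ : 1 < γ) (hf : HasDerivAt f f' x)
    (hg : HasDerivAt g g' x) (hx : 0 < f x) :
    deriv (fun y => g y ^ 2 / f y + pressure γ (f y)) x =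
      (2 * g x * g' * f x - g x ^ 2 * f') / f x ^ 2 + theta γ ^ 2 * (f x ^ theta γ) ^ 2 * f' := by
  have key := ((hg.pow 2).div hf hx.ne').add
    ((hf.rpow_const (p := γ) (Or.inl hx.ne')).const_mul (theta γ ^ 2 / γ))
  refine (key.congr_deriv ?_).deriv
  have hp : f x ^ (γ - 1) = (f x ^ theta γ) ^ 2 := by
    rw [← Real.rpow_mul_natCast hx.le]
    congr 1
    simp [theta]
  rw [hp]
  have : γ ≠ 0 := by positivity
  simp only [Pi.pow_apply]
  field_simp
  ring

/-- The pointwise maximum principle for `W = σ u + ρ ^ θ`, as an inequality between the jets of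
`(ρ, q)`. Here `r`, `r₁`, `r₂` and `m`, `m₁`, `m₂` are `ρ`, `q` and their first two space
derivatives, `P = ρ ^ θ`, and `c` is the truncation factor; the hypotheses say `W_x = 0`,
`W_xx ≤ 0` and `σ u ≥ 0`, and the conclusion is `W_t ≤ 0`. -/
theorem riemann_source_nonpos {θ σ c r r₁ r₂ m m₁ m₂ P : ℝ} (hθ : 0 < θ) (hε : 0 < ε)
    (hδ : 0 ≤ δ) (hδα : δ ≤ α) (hσ : σ ^ 2 = 1) (hr : 0 < r) (hP : 0 < P)
    (hx : σ * ((m₁ * r - m * r₁) / r ^ 2) + r₁ * θ * (P / r) = 0)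
    (hxx : σ * ((m₂ * r - m * r₂) / r ^ 2 - 2 * r₁ * (m₁ * r - m * r₁) / r ^ 3)
      + r₂ * θ * (P / r) + r₁ ^ 2 * θ * (θ - 1) * (P / r ^ 2) ≤ 0)
    (hu : 0 ≤ σ * (m / r)) :
    σ * (((-(c * ((2 * m * m₁ * r - m ^ 2 * r₁) / r ^ 2 + θ ^ 2 * P ^ 2 * r₁)) - α * m + ε * m₂) * r
        - m * (-(c * m₁) - δ * r + ε * r₂)) / r ^ 2)
      + (-(c * m₁) - δ * r + ε * r₂) * θ * (P / r) ≤ 0 := by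
  set Wx := σ * ((m₁ * r - m * r₁) / r ^ 2) + r₁ * θ * (P / r) with hWx
  set Wxx := σ * ((m₂ * r - m * r₂) / r ^ 2 - 2 * r₁ * (m₁ * r - m * r₁) / r ^ 3)
      + r₂ * θ * (P / r) + r₁ ^ 2 * θ * (θ - 1) * (P / r ^ 2) with hWxx
  have hid : σ * (((-(c * ((2 * m * m₁ * r - m ^ 2 * r₁) / r ^ 2 + θ ^ 2 * P ^ 2 * r₁))
        - α * m + ε * m₂) * r - m * (-(c * m₁) - δ * r + ε * r₂)) / r ^ 2)
      + (-(c * m₁) - δ * r + ε * r₂) * θ * (P / r)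
      = -(c * (m / r + σ * θ * P)) * Wx + 2 * ε * r₁ / r * Wx + ε * Wxx
        - ε * (θ * (θ + 1) * P * (r₁ / r) ^ 2) - (α - δ) * (σ * (m / r)) - δ * θ * P := by
    rw [hWx, hWxx]
    -- Only the transport term `c σ θ P W_x` contains `σ ^ 2`.
    have hs : σ * θ * P * (σ * ((m₁ * r - m * r₁) / r ^ 2))
        = θ * P * ((m₁ * r - m * r₁) / r ^ 2) := by
      linear_combination θ * P * ((m₁ * r - m * r₁) / r ^ 2) * hσ
    have hs' : -(c * (m / r + σ * θ * P)) * (σ * ((m₁ * r - m * r₁) / r ^ 2) + r₁ * θ * (P / r))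
        = -(c * (m / r)) * (σ * ((m₁ * r - m * r₁) / r ^ 2) + r₁ * θ * (P / r))
          - c * (θ * P * ((m₁ * r - m * r₁) / r ^ 2) + σ * θ * P * (r₁ * θ * (P / r))) := by
      rw [← hs]; ring
    rw [hs']
    field_simp
    ring
  rw [hid, hx]
  have h1 : 0 ≤ ε * (θ * (θ + 1) * P * (r₁ / r) ^ 2) := by positivity
  have h2 : 0 ≤ (α - δ) * (σ * (m / r)) := mul_nonneg (sub_nonneg.2 hδα) hu
  have h3 : 0 ≤ δ * θ * P := by positivity
  have h4 : ε * Wxx ≤ 0 := mul_nonpos_of_nonneg_of_nonpos hε.le hxx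
  linarith

theorem IsClassicalSolution.exists_hasDerivAt_signedRiemann_nonpos (hγ : 1 < γ) (hε : 0 < ε)
    (hδ : 0 ≤ δ) (hδα : δ ≤ α) (h : IsClassicalSolution γ α ε δ χ ρ q) {t : ℝ} (ht : 0 < t)
    (hpos : ∀ y, 0 < ρ t y) {σ x : ℝ} (hσ : σ ^ 2 = 1)
    (hmax : ∀ y, signedRiemann γ σ (ρ t y) (q t y) ≤ signedRiemann γ σ (ρ t x) (q t x))
    (hu : 0 ≤ σ * (q t x / ρ t x)) :
    ∃ d ≤ 0, HasDerivAt (fun s => signedRiemann γ σ (ρ s x) (q s x)) d t := by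
  have hρ := h.contDiff_rho t ht
  have hq := h.contDiff_q t ht
  have hρ1 := (hρ.differentiable two_ne_zero x).hasDerivAt
  have hq1 := (hq.differentiable two_ne_zero x).hasDerivAt
  have hr := hpos x
  have hloc : IsLocalMax (fun y => signedRiemann γ σ (ρ t y) (q t y)) x :=
    Eventually.of_forall hmax
  have hW := hasDerivAt_signedRiemann (γ := γ) σ hρ1 hq1 hr
  have hx := hloc.hasDerivAt_eq_zero hW
  have hxx := deriv_deriv_nonpos_of_isLocalMax hloc hW.continuousAt
  rw [deriv_deriv_signedRiemann σ x hρ hq hpos] at hxx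
  have hmom := h.momentum_eq t ht x
  rw [deriv_flux hγ hρ1 hq1 hr] at hmom
  refine ⟨_, ?_, hasDerivAt_signedRiemann σ (h.mass_eq t ht x) hmom hr⟩
  have hP1 : ρ t x ^ (theta γ - 1) = ρ t x ^ theta γ / ρ t x := Real.rpow_sub_one hr.ne' _
  have hP2 : ρ t x ^ (theta γ - 2) = ρ t x ^ theta γ / ρ t x ^ 2 := by
    rw [Real.rpow_sub hr, Real.rpow_two]
  rw [hP1] at hx hxx ⊢
  rw [hP2] at hxx
  have hθ : 0 < theta γ := by unfold theta; linarith
  exact riemann_source_nonpos hθ hε hδ hδα hσ hr (Real.rpow_pos_of_pos hr _) hx hxx hu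

/-! ### Invariance of the region -/

theorem mem_region_iff {U : ℝ × ℝ} :
    U ∈ region γ κ ↔ 0 < U.1 ∧ signedRiemann γ 1 U.1 U.2 ≤ κ ∧ signedRiemann γ (-1) U.1 U.2 ≤ κ := by
  simp only [region, riemannZ, riemannW, signedRiemann, mem_ofPred_eq]
  constructor
  · rintro ⟨h, h1, -, h3⟩
    exact ⟨h, by linarith, by linarith⟩
  · rintro ⟨h, h1, h2⟩
    exact ⟨h, by linarith, by linarith [Real.rpow_pos_of_pos h (theta γ)], by linarith⟩

theorem isInvariantRegion_region (hγ : 1 < γ) (hε : 0 < ε) (hR : 0 < R) (hχ : IsCutoff R χ)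
    (hδ : 0 ≤ δ) (hδα : δ ≤ α) : IsInvariantRegion γ α ε δ χ (region γ κ) := by
  rintro _ _ - - - - hinit ρ q h rfl rfl t ht x
  have hpos : ∀ t, 0 ≤ t → ∀ x, 0 < ρ t x := fun t ht x =>
    h.rho_pos hε hδ hR hχ (fun y => (hinit y).1) ht x
  let W : ℝ → ℝ → ℝ → ℝ := fun σ t x => signedRiemann γ σ (ρ t x) (q t x)
  have hWc : ∀ σ, ContinuousOn (fun p : ℝ × ℝ => W σ p.1 p.2) (Ici 0 ×ˢ univ) := fun σ =>
    ((h.continuous_q.div h.continuous_rho fun p hp => (hpos p.1 hp.1 p.2).ne').const_smul σ).add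
      (h.continuous_rho.rpow_const fun p hp => Or.inl (hpos p.1 hp.1 p.2).ne')
  have hWper : ∀ σ t, 0 ≤ t → Function.Periodic (W σ t) 1 := fun σ t ht y => by
    simp only [W, h.periodic_rho t ht y, h.periodic_q t ht y]
  have hbar : ∀ η > 0, max (W 1 t x) (W (-1) t x) < κ + η * (1 + t) := by
    intro η hη
    by_contra! hcross
    obtain ⟨s, hs, hbef, hle, y, hy⟩ := exists_first_crossing
      (G := fun t x => max (W 1 t x) (W (-1) t x) - (κ + η * (1 + t)))
      (((hWc 1).sup (hWc (-1))).sub (by fun_prop))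
      (fun t ht y => by simp only [hWper _ t ht y])
      (fun y => by
        obtain ⟨-, h1, h2⟩ := mem_region_iff.1 (hinit y)
        have := max_le h1 h2
        simp only [W]
        linarith)
      (X := x) ht (sub_nonneg.2 hcross)
    -- Whichever invariant touches the barrier first, the other one has not crossed it.
    have main : ∀ σ : ℝ, σ ^ 2 = 1 → W σ s y = κ + η * (1 + s) → W (-σ) s y ≤ κ + η * (1 + s) →
        (∀ r z, W σ r z ≤ max (W 1 r z) (W (-1) r z)) → False := by
      intro σ hσ h1 h2 h3
      have hu : 0 ≤ σ * (q s y / ρ s y) := by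
        simp only [W, signedRiemann] at h1 h2
        linarith
      obtain ⟨d, hd, hder⟩ := h.exists_hasDerivAt_signedRiemann_nonpos hγ hε hδ hδα hs
        (hpos s hs.le) hσ (x := y)
        (fun z => by
          have := (h3 s z).trans (sub_nonpos.1 (hle z))
          exact this.trans h1.ge) hu
      have hb : HasDerivAt (fun r : ℝ => κ + η * (1 + r)) η s := by
        simpa using (((hasDerivAt_id s).const_add 1).const_mul η).const_add κ
      have := deriv_nonneg_of_neg_before hs (hder.sub hb) (sub_eq_zero.2 h1) fun r hr hrs =>
        sub_neg.2 ((h3 r y).trans_lt (sub_neg.1 (hbef r hr hrs y)))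
      linarith
    have hy' := sub_eq_zero.1 hy
    rcases le_total (W 1 s y) (W (-1) s y) with hc | hc
    · rw [max_eq_right hc] at hy'
      exact main (-1) (by norm_num) hy' (by rw [neg_neg]; exact hc.trans hy'.le)
        fun r z => le_max_right _ _
    · rw [max_eq_left hc] at hy'
      exact main 1 (by norm_num) hy' (hc.trans hy'.le) fun r z => le_max_left _ _
  have hle : max (W 1 t x) (W (-1) t x) ≤ κ := by
    refine le_of_forall_pos_lt_add fun e he => ?_
    have h1t : 0 < 1 + t := by linarith
    have := hbar (e / (1 + t)) (div_pos he h1t)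
    rwa [div_mul_cancel₀ _ h1t.ne'] at this
  exact mem_region_iff.2 ⟨hpos t ht x, (le_max_left _ _).trans hle, (le_max_right _ _).trans hle⟩

end TruncatedEuler

theorem proposition3p2 (γ α ε R : ℝ) (hγ : 1 < γ) (hα : 0 < α) (hε : 0 < ε) (hR : 0 < R)
    (χ : ℝ → ℝ) (hχ : TruncatedEuler.IsCutoff R χ) (κ : ℝ) (hκ : 0 < κ) :
    TruncatedEuler.IsInvariantRegion γ α ε 0 χ (TruncatedEuler.region γ κ) ∧
      ∀ δ : ℝ, 0 < δ → δ < α →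
        TruncatedEuler.IsInvariantRegion γ α ε δ χ (TruncatedEuler.region γ κ) :=
  ⟨TruncatedEuler.isInvariantRegion_region hγ hε hR hχ le_rfl hα.le, fun _ hδ hδα =>
    TruncatedEuler.isInvariantRegion_region hγ hε hR hχ hδ.le hδα.le⟩
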